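/- Consider diagrams in the plane of balanced-oriented knotted 4-valent graphs with rigid vertices: each edge is oriented, and at each vertex two edges come in and two go out, so that the cyclic type of a vertex is In-In-Out-Out (IIOO) or In-Out-In-Out (IOIO); components that are circles without vertices are allowed. Diagrams are taken up to planar isotopy. The oriented Reidemeister-type moves are all oriented versions (36 up to planar isotopy) of the following moves: - $\Omega1$ (4 moves): remove a curl from a strand; - $\Omega2$ (4 moves): separate two strands, one of which passes over the other at two consecutive crossings; - $\Omega3$ (8 moves): move a strand over or under a crossing of two other strands, or between these; - $\Omega4$ (8 moves for IIOO vertices, 4 moves for IOIO vertices): move a strand over or under a vertex, from one pair of adjacent edges to the opposite pair; - $\Omega5$ (6 moves for IIOO vertices, 2 moves for IOIO vertices): trade a crossing of two adjacent edges at a vertex for a crossing, with the same handedness of the half-twist, of the other two edges, the vertex being flipped over. Among them are: - $\Omega1a$, $\Omega1b$: a curl with a positive crossing, running clockwise in $\Omega1a$ and counterclockwise in $\Omega1b$; - $\Omega2a$: two parallel strands of which, seen along their common direction, the left one passes over the right one; - $\Omega3a$: the triangle is cyclically oriented, the crossing of the highest and the lowest strand is negative, and the other two crossings are positive; - $\Omega4a$,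 $\Omega4e$: a strand passes over (in $\Omega4a$) or under (in $\Omega4e$) an IIOO vertex, crossing one outgoing and one incoming edge on either side of the move, and the triangle formed by the strand and these two edges is cyclically oriented; - $\Omega5a$: a positive crossing of the two incoming edges of an IIOO vertex is traded for a positive crossing of the two outgoing edges; - $\Omega4j$, $\Omega4l$: a strand passes under (in $\Omega4j$) or over (in $\Omega4l$) an IOIO vertex; on the side of the move on which the triangle formed by the strand and two edges is cyclically oriented, it is oriented counterclockwise; - $\Omega5g$: a negative crossing of two adjacent edges at an IOIO vertex is traded for a negative crossing of the other two edges. A set $S$ of oriented Reidemeister-type moves is called generating if, whenever a diagram $D'$ arises from a diagram $D$ by one of the oriented Reidemeister-type moves, $D$ and $D'$ are joined by a finite sequence of planar isotopies and of moves in $S$, each applied in either direction. Theorem. The set $\{\Omega1a,\Omega1b,\Omega2a,\Omega3a,\Omega4a,\Omega4e,\Omega5a,\Omega4j,\Omega4l,\Omega5g\}$ is a minimal generating set of the oriented Reidemeister-type moves: it is generating, and no proper subset of it is generating. -/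

import Mathlib

/-!
Diagrams of balanced-oriented knotted 4-valent graphs with rigid vertices, up to planar isotopy.

Diagrams are written in Morse position with respect to the height function of the plane: a diagram
is cut by horizontal lines into slices, and each slice holds one local maximum, local minimum,
crossing or vertex, next to vertical strands. A horizontal line at a regular level meets the
diagram in a finite row of oriented strands, recorded as a `List Bool` from left to right, where
`true` means that the strand is directed upward and `false` that it is directed downward.
-/

namespace KnottedGraph

/-- The elementary pieces of an oriented diagram. Crossings and vertices are drawn with two legs
below (south-west, south-east) and two legs above (north-west, north-east). -/
inductive Piece : Type
  /-- A local minimum; its left end has direction `a`, its right end the opposite one. -/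
  | cup (a : Bool)
  /-- A local maximum; its left end has direction `a`, its right end the opposite one. -/
  | cap (a : Bool)
  /-- A crossing of a strand SW-NE of direction `a` with a strand SE-NW of direction `b`.
  The strand SW-NE is the over-strand if `o = true`, and the under-strand if `o = false`. Thus
  the crossing is positive if and only if `o = (a == b)`. -/
  | crossing (o a b : Bool)
  /-- A vertex of type In-In-Out-Out: of two opposite edges, one comes in and one goes out. The
  edges SW and NE have direction `a`, the edges SE and NW have direction `b`. -/
  | vertexIIOO (a b : Bool)
  /-- A vertex of type In-Out-In-Out: opposite edges both come in or both go out. The edges SW and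
  NW have direction `a`, the edges SE and NE have the opposite direction. -/
  | vertexAlternating (a : Bool)

namespace Piece

/-- The strands at the bottom of a piece, from left to right. -/
def source : Piece → List Bool
  | cup _ => []
  | cap a => [a, !a]
  | crossing _ a b => [a, b]
  | vertexIIOO a b => [a, b]
  | vertexAlternating a => [a, !a]

/-- The strands at the top of a piece, from left to right. -/
def target : Piece → List Bool
  | cup a => [a, !a]
  | cap _ => []
  | crossing _ a b => [b, a]
  | vertexIIOO a b => [b, a]
  | vertexAlternating a => [a, !a]

end Piece

/-- A tangle word: the slices from bottom to top. The slice `(k, g)` consists of the piece `g` with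
`k` vertical strands to its left (and any number of vertical strands to its right). -/
abbrev Word : Type := List (ℕ × Piece)

/-- Add `n` vertical strands to the left of a tangle word. -/
def shift (n : ℕ) (w : Word) : Word := w.map fun x => (n + x.1, x.2)

/-- `IsTangle w s t`: the slices of `w` fit together, directions included, to an oriented tangle
diagram with the row of strands `s` at the bottom and the row `t` at the top. -/
inductive IsTangle : Word → List Bool → List Bool → Prop
  | nil (s : List Bool) : IsTangle [] s s
  | cons (g : Piece) (w : Word) (p q t : List Bool)
      (h : IsTangle w (p ++ g.target ++ q) t) :
      IsTangle ((p.length, g) :: w) (p ++ g.source ++ q) t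

/-- A diagram of a balanced-oriented knotted 4-valent graph in the plane: a tangle diagram without
end points. Circles without crossings and vertices, and the empty diagram, are included. -/
structure Diagram : Type where
  /-- The slices from bottom to top. -/
  word : Word
  closed : IsTangle word [] []

/-- `D'` arises from `D` when a part of `D` that is the tangle `L` (with `n` strands of `D` to its
left) is replaced by the tangle `R`, the rest of the diagram being unchanged. -/
def Replaces (L R : Word) (D D' : Diagram) : Prop :=
  ∃ (n : ℕ) (u v : Word), D.word = u ++ shift n L ++ v ∧ D'.word = u ++ shift n R ++ v

/-- The elementary planar isotopies of diagrams in Morse position. -/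
inductive PlanarRule : Word → Word → Prop
  /-- Two pieces next to each other exchange their heights. -/
  | exchange (g h : Piece) (m : ℕ) :
      PlanarRule [(0, g), (g.target.length + m, h)] [(g.source.length + m, h), (0, g)]
  /-- A local minimum and an adjacent local maximum of a strand cancel. -/
  | zigzagLeft (a : Bool) : PlanarRule [(0, .cup a), (1, .cap (!a))] []
  | zigzagRight (a : Bool) : PlanarRule [(1, .cup a), (0, .cap (!a))] []
  /-- A crossing or vertex below the left leg of a local maximum moves through the maximum to
  its other leg and thereby turns clockwise by a right angle. -/
  | turnCrossing (o a b : Bool) :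
      PlanarRule [(0, .crossing o a b), (1, .cap a)] [(1, .crossing (!o) b (!a)), (0, .cap a)]
  | turnIIOO (a b : Bool) :
      PlanarRule [(0, .vertexIIOO a b), (1, .cap a)] [(1, .vertexIIOO b (!a)), (0, .cap a)]
  | turnAlternating (a : Bool) :
      PlanarRule [(0, .vertexAlternating a), (1, .cap (!a))] [(1, .vertexAlternating (!a)), (0, .cap a)]

/-- The oriented Reidemeister-type moves, one for each move up to planar isotopy (a rotation of the
plane by a half-turn may exchange the two sides of a move): 4 moves `Ω1`, 4 moves `Ω2`, 8 moves
`Ω3`, 8 + 4 moves `Ω4` and 6 + 2 moves `Ω5`. -/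
inductive Move : Type
  /-- A strand of direction `a` with a curl on its right; the crossing is positive if `o = true`
  and negative if `o = false`. -/
  | omega1 (o a : Bool)
  /-- The left strand, of direction `a`, passes over the right strand, of direction `b`. -/
  | omega2 (a b : Bool)
  /-- Three strands, the strands that start at the bottom left, middle and right having the
  directions `a`, up and `b`; their heights decrease from left to right if `o = true` and increase
  from left to right if `o = false`. -/
  | omega3 (o a b : Bool)
  /-- A strand directed from the left to the right passes over (`o = true`) or under (`o = false`)
  the vertex `vertexIIOO a b`. -/
  | omega4IIOO (o a b : Bool)
  /-- A strand directed from the left to the right passes over (`o = true`) or under (`o = false`)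
  the vertex `vertexAlternating a`. -/
  | omega4Alternating (o a : Bool)
  /-- A crossing, positive if `o = true` and negative if `o = false`, of the two incoming edges of
  an In-In-Out-Out vertex is traded for one of the two outgoing edges. -/
  | omega5Parallel (o : Bool)
  /-- A crossing of an incoming and an outgoing edge of an In-In-Out-Out vertex is traded for one
  of the other incoming and the other outgoing edge; the lower ends have directions `a`, `!a`. -/
  | omega5Antiparallel (o a : Bool)
  /-- A crossing, negative if `o = true` and positive if `o = false`, of two adjacent edges of an
  In-Out-In-Out vertex is traded for one of the other two edges. -/
  | omega5Alternating (o : Bool)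

namespace Move

/-- One side of a move. -/
def left : Move → Word
  | omega1 o a => [(1, .cup a), (0, .crossing o a a), (1, .cap a)]
  | omega2 a b => [(0, .crossing true a b), (0, .crossing false b a)]
  | omega3 o a b => [(0, .crossing o a true), (1, .crossing o a b), (0, .crossing o true b)]
  | omega4IIOO o a b => [(0, .crossing o true a), (1, .crossing o true b), (0, .vertexIIOO a b)]
  | omega4Alternating o a => [(0, .crossing o true a), (1, .crossing o true (!a)), (0, .vertexAlternating a)]
  | omega5Parallel o => [(0, .crossing o true true), (0, .vertexIIOO true true)]
  | omega5Antiparallel o a => [(0, .crossing o a (!a)), (0, .vertexIIOO (!a) a)]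
  | omega5Alternating o => [(0, .crossing o true false), (0, .vertexAlternating false)]

/-- The other side of a move. -/
def right : Move → Word
  | omega1 _ _ => []
  | omega2 _ _ => []
  | omega3 o a b => [(1, .crossing o true b), (0, .crossing o a b), (1, .crossing o a true)]
  | omega4IIOO o a b => [(1, .vertexIIOO a b), (0, .crossing o true b), (1, .crossing o true a)]
  | omega4Alternating o a => [(1, .vertexAlternating a), (0, .crossing o true a), (1, .crossing o true (!a))]
  | omega5Parallel o => [(0, .vertexIIOO true true), (0, .crossing o true true)]
  | omega5Antiparallel o a => [(0, .vertexIIOO a (!a)), (0, .crossing o (!a) a)]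
  | omega5Alternating o => [(0, .vertexAlternating true), (0, .crossing o true false)]

/-- Upward strand, positive curl (clockwise). -/
def Ω1a : Move := omega1 true true

/-- Downward strand, positive curl (counterclockwise). -/
def Ω1b : Move := omega1 true false

/-- Two parallel strands; seen along their direction, the left one passes over the right one. -/
def Ω2a : Move := omega2 true true

/-- Cyclically oriented triangle with two positive crossings and one negative crossing, the negative
one being that of the highest and the lowest strand. -/
def Ω3a : Move := omega3 false false false

/-- The strand passes over the vertex, whose two incoming edges lie in front of the strand and whose
two outgoing edges lie behind: the triangle is cyclically oriented on both sides of the move. -/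
def Ω4a : Move := omega4IIOO true false true

/-- The same as `Ω4a`, with the strand passing under the vertex. -/
def Ω4e : Move := omega4IIOO false false true

/-- Parallel strands, positive crossing. -/
def Ω5a : Move := omega5Parallel true

/-- The strand passes under the vertex; where the triangle is cyclically oriented, it is so
counterclockwise. -/
def Ω4j : Move := omega4Alternating false false

/-- The same as `Ω4j`, with the strand passing over the vertex. -/
def Ω4l : Move := omega4Alternating true false

/-- Negative crossing. -/
def Ω5g : Move := omega5Alternating true

end Move

/-- One application of a planar isotopy, or of one of the moves in `S`. -/
def Step (S : Set Move) (D D' : Diagram) : Prop :=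
  (∃ L R : Word, PlanarRule L R ∧ Replaces L R D D') ∨ ∃ m ∈ S, Replaces m.left m.right D D'

/-- `D` and `D'` are joined by a finite sequence of planar isotopies and moves in `S`, each in
either direction. -/
def Joined (S : Set Move) : Diagram → Diagram → Prop := Relation.EqvGen (Step S)

/-- `S` is a generating set of the oriented Reidemeister-type moves: every application of every move
to a diagram is obtained by a finite sequence of applications of moves in `S`. -/
def Generates (S : Set Move) : Prop :=
  ∀ (m : Move) (D D' : Diagram), Replaces m.left m.right D D' → Joined S D D'

end KnottedGraph

namespace KnottedGraph

-- Generation is local: tangles with common ends that can be exchanged inside every diagram form a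
-- congruence, `TangleEq`, and it suffices to derive the relation of each move there. For links the
-- tool is the curl. A curl put on one strand of a bigon forms a triangle with the two crossings; Ω3
-- carries the other strand across it, and there it meets the loop, which runs backwards. So
-- parallel bigons give antiparallel ones and conversely (`Bigon.antiparallel`, `Bigon.parallel`),
-- and antiparallel bigons give the negative curls (`Curl.mirror`). Once Ω2 is complete, inverting a
-- crossing (`Triangle.swap`) and turning by a sixth of a full turn (`Triangle.rotate`) lead from
-- Ω3a to every Ω3. For Ω4 the vertex is turned by right angles (`Pass.rotate`). For Ω5, crossings
-- are inverted, stacks are turned by a half-turn, and a curl is carried past the vertex and back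
-- (`trade_antiparallel`).
--
-- Minimality needs, for each of the ten moves, an invariant of planar isotopy and of the other nine
-- moves that this move changes. All ten are numbers of colourings of the strands by local rules, so
-- that invariance is a finite check on each relation (`Colouring.mem_of_generates`). Writhe
-- combined with rotation separates the two Ω1 moves, connectedness detects Ω2a, an operation that
-- is not self-distributive detects Ω3a, Fox colourings vanishing at vertices separate over from
-- under in Ω4, and prescribed leg colours and smoothings detect the two Ω5 moves.

deriving instance DecidableEq for Piece

/-! ### Typing of tangle words -/

/-- The row of strands at the top of a tangle word with the row `s` at the bottom, if the slices fit
together. -/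
def run : List Bool → Word → Option (List Bool)
  | s, [] => some s
  | s, (k, g) :: w =>
    if k ≤ s.length ∧ g.source.isPrefixOf (s.drop k) = true then
      run (s.take k ++ g.target ++ s.drop (k + g.source.length)) w
    else none

theorem IsTangle.of_run {w : Word} {s t : List Bool} (h : run s w = some t) : IsTangle w s t := by
  induction w generalizing s with
  | nil => simp only [run, Option.some.injEq] at h; exact h ▸ .nil s
  | cons x w ih =>
    obtain ⟨k, g⟩ := x
    rw [run] at h
    split_ifs at h with hk
    obtain ⟨hk, hg⟩ := hk
    obtain ⟨q, hq⟩ := List.isPrefixOf_iff_prefix.1 hg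
    have hs : s = s.take k ++ g.source ++ q := by
      rw [List.append_assoc, hq, List.take_append_drop]
    have hl : (s.take k).length = k := by simpa using hk
    have hd : s.drop (k + g.source.length) = q := by rw [← List.drop_drop, ← hq]; simp
    rw [hd] at h
    have := IsTangle.cons g w (s.take k) q t (ih h)
    rwa [hl, ← hs] at this

theorem IsTangle.run_eq {w : Word} {s t : List Bool} (h : IsTangle w s t) : run s w = some t := by
  induction h with
  | nil s => rfl
  | cons g w p q t _ ih =>
    rw [run, if_pos]
    · rw [← ih]; congr 1; simp
    · exact ⟨by simp, by simp⟩

theorem IsTangle.append {u v : Word} {s r t : List Bool} (hu : IsTangle u s r)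
    (hv : IsTangle v r t) : IsTangle (u ++ v) s t := by
  induction hu with
  | nil s => exact hv
  | cons g w p q t _ ih => exact .cons g _ p q _ (ih hv)

theorem IsTangle.of_append {u v : Word} {s t : List Bool} (h : IsTangle (u ++ v) s t) :
    ∃ r, IsTangle u s r ∧ IsTangle v r t := by
  induction u generalizing s with
  | nil => exact ⟨s, .nil s, h⟩
  | cons x u ih =>
    cases h with
    | cons g w p q t h =>
      obtain ⟨r, h₁, h₂⟩ := ih h
      exact ⟨r, .cons g u p q r h₁, h₂⟩

@[simp] theorem shift_nil (n : ℕ) : shift n [] = [] := rfl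

@[simp] theorem shift_cons (n : ℕ) (x : ℕ × Piece) (w : Word) :
    shift n (x :: w) = (n + x.1, x.2) :: shift n w := rfl

@[simp] theorem shift_append (n : ℕ) (u v : Word) : shift n (u ++ v) = shift n u ++ shift n v := by
  simp [shift]

theorem shift_shift (m n : ℕ) (w : Word) : shift m (shift n w) = shift (m + n) w := by
  simp [shift, Function.comp_def, Nat.add_assoc]

theorem shift_zero (w : Word) : shift 0 w = w := by simp [shift]

theorem IsTangle.whisker {w : Word} {s t : List Bool} (h : IsTangle w s t) (p q : List Bool) :
    IsTangle (shift p.length w) (p ++ s ++ q) (p ++ t ++ q) := by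
  induction h with
  | nil s => exact .nil _
  | cons g w p' q' t _ ih =>
    have := IsTangle.cons g (shift p.length w) (p ++ p') (q' ++ q) _ (by simpa using ih)
    simpa using this

/-- The bound `hn` matters for the empty word, which is a tangle on every row, however short. -/
theorem IsTangle.of_shift {n : ℕ} {w : Word} {r r' : List Bool} (h : IsTangle (shift n w) r r')
    (hn : n ≤ r.length) :
    ∃ p x y, p.length = n ∧ r = p ++ x ∧ r' = p ++ y ∧ IsTangle w x y := by
  induction w generalizing r with
  | nil =>
    cases h
    exact ⟨r'.take n, r'.drop n, r'.drop n, by simpa using hn, by simp, by simp, .nil _⟩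
  | cons x w ih =>
    obtain ⟨k, g⟩ := x
    generalize hW : shift n ((k, g) :: w) = W at h
    cases h with
    | nil => simp at hW
    | cons g' w' p q _ h =>
      simp only [shift_cons, List.cons.injEq, Prod.mk.injEq] at hW
      obtain ⟨⟨hk, rfl⟩, rfl⟩ := hW
      obtain ⟨p', x, y, h₁, h₂, h₃, h₄⟩ := ih h (by simp; omega)
      have hp : p = p' ++ p.drop n := by
        have h₅ := congrArg (List.take n) h₂
        rw [List.append_assoc, List.take_append_of_le_length (by omega), List.take_left' h₁] at h₅
        rw [← h₅, List.take_append_drop]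
      have hx : x = p.drop n ++ g.target ++ q := by
        rw [hp] at h₂
        simpa using h₂.symm
      refine ⟨p', p.drop n ++ g.source ++ q, y, h₁, ?_, h₃, ?_⟩
      · conv_lhs => rw [hp]
        simp
      · have h₅ := IsTangle.cons g w (p.drop n) q y (hx ▸ h₄)
        have : (p.drop n).length = k := by rw [List.length_drop]; omega
        rwa [this] at h₅

/-! ### Equivalence of tangle words -/

/-- Tangle diagrams with the same ends that are exchangeable inside every diagram by planar
  isotopies
and moves in `S`. -/
structure TangleEq (S : Set Move) (s t : List Bool) (w w' : Word) : Prop where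
  left : IsTangle w s t
  right : IsTangle w' s t
  joined (p q : List Bool) (u v : Word) (hu : IsTangle u [] (p ++ s ++ q))
    (hv : IsTangle v (p ++ t ++ q) []) (D D' : Diagram)
    (hD : D.word = u ++ shift p.length w ++ v) (hD' : D'.word = u ++ shift p.length w' ++ v) :
    Joined S D D'

variable {S : Set Move} {s t s₀ t₀ p q r : List Bool} {w w' w'' u v L R : Word}

theorem Diagram.eq_of_word_eq {D D' : Diagram} (h : D.word = D'.word) : D = D' := by
  cases D; cases D'; cases h; rfl

namespace TangleEq

theorem refl (h : IsTangle w s t) : TangleEq S s t w w :=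
  ⟨h, h, fun _ _ _ _ _ _ D D' hD hD' => by
    rw [Diagram.eq_of_word_eq (hD.trans hD'.symm)]; exact .refl _⟩

theorem symm (h : TangleEq S s t w w') : TangleEq S s t w' w :=
  ⟨h.right, h.left, fun p q u v hu hv D D' hD hD' => (h.joined p q u v hu hv D' D hD' hD).symm⟩

theorem trans (h : TangleEq S s t w w') (h' : TangleEq S s t w' w'') : TangleEq S s t w w'' :=
  ⟨h.left, h'.right, fun p q u v hu hv D D' hD hD' =>
    let E : Diagram := ⟨u ++ shift p.length w' ++ v, (hu.append (h.right.whisker p q)).append hv⟩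
    (h.joined p q u v hu hv D E hD rfl).trans _ _ _ (h'.joined p q u v hu hv E D' rfl hD')⟩

instance : Trans (TangleEq S s t) (TangleEq S s t) (TangleEq S s t) := ⟨trans⟩

theorem of_step (h : IsTangle w s t) (h' : IsTangle w' s t)
    (H : ∀ D D' : Diagram, Replaces w w' D D' → Step S D D') : TangleEq S s t w w' :=
  ⟨h, h', fun p _ u v _ _ D D' hD hD' => .rel _ _ (H D D' ⟨p.length, u, v, hD, hD'⟩)⟩

theorem of_rule (h : PlanarRule w w') (hw : IsTangle w s t) (hw' : IsTangle w' s t) :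
    TangleEq S s t w w' :=
  of_step hw hw' fun _ _ H => .inl ⟨w, w', h, H⟩

theorem of_move {m : Move} (h : m ∈ S) (hw : IsTangle m.left s t) (hw' : IsTangle m.right s t) :
    TangleEq S s t m.left m.right :=
  of_step hw hw' fun _ _ H => .inr ⟨m, h, H⟩

theorem context (h : TangleEq S s t w w') (hu : IsTangle u s₀ (p ++ s ++ q))
    (hv : IsTangle v (p ++ t ++ q) t₀) :
    TangleEq S s₀ t₀ (u ++ shift p.length w ++ v) (u ++ shift p.length w' ++ v) := by
  refine ⟨(hu.append (h.left.whisker p q)).append hv, (hu.append (h.right.whisker p q)).append hv,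
    fun p' q' u' v' hu' hv' D D' hD hD' => ?_⟩
  refine h.joined (p' ++ p) (q ++ q') (u' ++ shift p'.length u) (shift p'.length v ++ v') ?_ ?_ D D'
    ?_ ?_
  · simpa using hu'.append (hu.whisker p' q')
  · simpa using (hv.whisker p' q').append hv'
  · simp [hD, shift_shift]
  · simp [hD', shift_shift]

theorem cons (g : Piece) (h : TangleEq S (p ++ g.target ++ q) t w w') :
    TangleEq S (p ++ g.source ++ q) t ((p.length, g) :: w) ((p.length, g) :: w') := by
  have h' := h.context (p := []) (q := []) (u := [(p.length, g)]) (v := [])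
    (s₀ := p ++ g.source ++ q) (t₀ := t)
    (by simpa using IsTangle.cons g [] p q _ (.nil _)) (by simpa using IsTangle.nil t)
  simpa [shift_zero] using h'

theorem exchange (g h : Piece) (m q : List Bool) :
    TangleEq S (g.source ++ m ++ h.source ++ q) (g.target ++ m ++ h.target ++ q)
      [(0, g), (g.target.length + m.length, h)] [(g.source.length + m.length, h), (0, g)] := by
  refine of_rule (.exchange g h m.length) ?_ ?_
  · have h₂ := IsTangle.cons h [] (g.target ++ m) q _ (.nil _)
    have h₁ := IsTangle.cons g _ [] (m ++ h.source ++ q) _ (by simpa using h₂)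
    simpa using h₁
  · have h₂ := IsTangle.cons g [] [] (m ++ h.target ++ q) _ (.nil _)
    have h₁ := IsTangle.cons h _ (g.source ++ m) q _ (by simpa using h₂)
    simpa using h₁

end TangleEq

/-! ### Tangle words up to exchanges of heights -/

/-- Put a slice below a tangle word and lift it over the slices to its right. -/
def lift (k : ℕ) (g : Piece) : Word → Word
  | [] => [(k, g)]
  | (j, h) :: w =>
    if k + g.target.length ≤ j then (j - g.target.length + g.source.length, h) :: lift k g w
    else (k, g) :: (j, h) :: w

/-- A tangle word up to exchanges of heights, with pieces on the right as low as possible. -/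
def settle : Word → Word
  | [] => []
  | (k, g) :: w => lift k g (settle w)

theorem TangleEq.lift {g : Piece} :
    ∀ {w : Word} {p q : List Bool}, IsTangle w (p ++ g.target ++ q) t →
      TangleEq S (p ++ g.source ++ q) t ((p.length, g) :: w) (lift p.length g w)
  | [], p, q, h => .refl (.cons _ _ _ _ _ h)
  | (j, h) :: w, p, q, H => by
    rw [KnottedGraph.lift]
    split_ifs with hj
    · generalize hrow : p ++ g.target ++ q = row at H
      cases H with
      | cons _ _ a b _ H =>
        -- By `hj` the piece `h` begins to the right of all upper legs of `g`; `m` consists of the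
        -- strands between the two pieces.
        obtain ⟨m, hm⟩ : ∃ m, a = p ++ g.target ++ m := by
          have h₁ : (p ++ g.target) <+: a := by
            refine List.prefix_of_prefix_length_le (l₃ := a ++ h.source ++ b) ⟨q, hrow⟩
              ⟨h.source ++ b, by simp⟩ (by simpa using hj)
          obtain ⟨m, rfl⟩ := h₁
          exact ⟨m, rfl⟩
        subst hm
        have hq : q = m ++ h.source ++ b := by simpa using hrow
        subst hq
        have h₁ := (TangleEq.exchange (S := S) g h m b).context (u := []) (v := w) (p := p) (q :=
          [])
          (t₀ := t) (.nil _) (by simpa using H)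
        have h₂ := TangleEq.lift (g := g) (w := w) (p := p) (q := m ++ h.target ++ b)
          (by simpa using H)
        have h₃ := TangleEq.cons (S := S) (p := p ++ g.source ++ m) (q := b) (t := t) h
          (by simpa using h₂)
        have e : (p ++ g.target ++ m).length - g.target.length + g.source.length
            = (p ++ g.source ++ m).length := by simp; omega
        rw [e]
        refine TangleEq.trans ?_ (by simpa using h₃)
        simpa [Nat.add_assoc] using h₁
    · exact .refl (.cons _ _ _ _ _ H)

theorem TangleEq.settle {w : Word} (h : IsTangle w s t) : TangleEq S s t w (settle w) := by
  induction h with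
  | nil s => exact .refl (.nil s)
  | cons g w p q t _ ih => exact (TangleEq.cons g ih).trans (.lift ih.right)

/-- Typing is invariant under exchanges, in both directions. -/
theorem IsTangle.of_lift {g : Piece} :
    ∀ {k : ℕ} {w : Word} {s : List Bool}, IsTangle (lift k g w) s t →
      IsTangle ((k, g) :: w) s t
  | k, [], s, h => h
  | k, (j, h) :: w, s, H => by
    rw [KnottedGraph.lift] at H
    split_ifs at H with hj
    · generalize hW : (j - g.target.length + g.source.length, h) :: KnottedGraph.lift k g w = W at H
      cases H with
      | nil => simp at hW
      | cons h' _ a b _ H =>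
        simp only [List.cons.injEq, Prod.mk.injEq] at hW
        obtain ⟨⟨hk, rfl⟩, rfl⟩ := hW
        have H' := IsTangle.of_lift H
        generalize hrow : a ++ h.target ++ b = row at H'
        cases H' with
        | cons _ _ p q _ H' =>
          obtain ⟨m, rfl⟩ : (p ++ g.source) <+: a := by
            refine List.prefix_of_prefix_length_le (l₃ := a ++ h.target ++ b)
              ⟨q, hrow.symm⟩ ⟨h.target ++ b, by simp⟩ (by simp; omega)
          have hq : q = m ++ h.target ++ b := by simpa using hrow.symm
          subst hq
          have h₂ := IsTangle.cons h w (p ++ g.target ++ m) b t (by simpa using H')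
          have h₁ := IsTangle.cons g _ p (m ++ h.source ++ b) t (by simpa using h₂)
          have e : (p ++ g.target ++ m).length = j := by simp at hk hj ⊢; omega
          rw [← e]
          simpa using h₁
    · exact H

theorem IsTangle.of_settle {w : Word} (h : IsTangle (settle w) s t) : IsTangle w s t := by
  induction w generalizing s with
  | nil => exact h
  | cons x w ih =>
    obtain ⟨k, g⟩ := x
    have h₁ := IsTangle.of_lift h
    cases h₁ with
    | cons _ _ p q _ h₁ => exact .cons g w p q t (ih h₁)

/-- Only the soundness of `settle` is used, not that it gives a canonical form. That `w'` is a
tangle is read back from its settled word. -/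
theorem TangleEq.of_settle_eq (h : IsTangle w s t) (e : KnottedGraph.settle w =
  KnottedGraph.settle w') :
    TangleEq S s t w w' := by
  have h₁ := TangleEq.settle (S := S) h
  have h₂ : IsTangle w' s t := .of_settle (e ▸ h₁.right)
  exact h₁.trans (e ▸ (TangleEq.settle h₂).symm)

/-- Replace a tangle inside a tangle word, up to exchanges of heights. -/
theorem TangleEq.replace (h : TangleEq S s₀ t₀ L R) (p q : List Bool) (u v : Word)
    -- The side conditions are evaluated for all values of the Boolean parameters; `clear * -` keeps
    -- other hypotheses out of the decision.
    (hw : KnottedGraph.settle w = KnottedGraph.settle (u ++ shift p.length L ++ v) := by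
      clear * -; first | rfl | decide +revert)
    (hw' : KnottedGraph.settle w' = KnottedGraph.settle (u ++ shift p.length R ++ v) := by
      clear * -; first | rfl | decide +revert)
    (hu : run s u = some (p ++ s₀ ++ q) := by clear * -; decide +revert)
    (hv : run (p ++ t₀ ++ q) v = some t := by clear * -; decide +revert) :
    TangleEq S s t w w' := by
  have h₁ := h.context (IsTangle.of_run hu) (IsTangle.of_run hv)
  exact (TangleEq.of_settle_eq h₁.left hw.symm).symm.trans
    (h₁.trans (TangleEq.of_settle_eq h₁.right hw'.symm))

end KnottedGraph

namespace KnottedGraph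

open Piece

/-! ### Pieces with four legs and their rotations -/

/-- Crossings and vertices. -/
inductive Quad : Type
  | crossing (o a b : Bool)
  | iioo (a b : Bool)
  | alternating (a : Bool)
  deriving DecidableEq, Fintype

namespace Quad

/-- The underlying piece of a crossing or vertex. -/
def piece : Quad → Piece
  | crossing o a b => .crossing o a b
  | iioo a b => .vertexIIOO a b
  | alternating a => .vertexAlternating a

/-- Direction of the south-west leg. -/
def sw : Quad → Bool
  | crossing _ a _ => a
  | iioo a _ => a
  | alternating a => a

/-- Direction of the south-east leg. -/
def se : Quad → Bool
  | crossing _ _ b => b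
  | iioo _ b => b
  | alternating a => !a

/-- Direction of the north-west leg. -/
def nw : Quad → Bool
  | crossing _ _ b => b
  | iioo _ b => b
  | alternating a => a

/-- Direction of the north-east leg. -/
def ne : Quad → Bool
  | crossing _ a _ => a
  | iioo a _ => a
  | alternating a => !a

/-- Clockwise rotation by a right angle. -/
def rot : Quad → Quad
  | crossing o a b => crossing (!o) b (!a)
  | iioo a b => iioo b (!a)
  | alternating a => alternating (!a)

end Quad

variable {S : Set Move} {s t : List Bool} {w w' : Word}

/-! ### Straightening zigzags and turning pieces through extrema -/

namespace TangleEq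

theorem zigzagLeft (a : Bool) : TangleEq S [a] [a] [(0, cup a), (1, cap (!a))] [] :=
  of_rule (.zigzagLeft a) (.of_run (by decide +revert)) (.nil _)

theorem zigzagRight (a : Bool) : TangleEq S [!a] [!a] [(1, cup a), (0, cap (!a))] [] :=
  of_rule (.zigzagRight a) (.of_run (by decide +revert)) (.nil _)

theorem turn (g : Quad) : TangleEq S [g.sw, g.se, !g.ne] [g.nw]
    [(0, g.piece), (1, cap g.ne)] [(1, g.rot.piece), (0, cap g.sw)] := by
  refine of_rule ?_ (.of_run (by decide +revert)) (.of_run (by decide +revert))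
  cases g with
  | crossing o a b => exact .turnCrossing o a b
  | iioo a b => exact .turnIIOO a b
  | alternating a => exact .turnAlternating a

/-- A zigzag made on the north-east leg provides a maximum through which the piece turns; this
leaves a zigzag on the south-west leg. -/
theorem turnCup (g : Quad) : TangleEq S [g.se] [!g.sw, g.nw, g.ne]
    [(0, cup (!g.sw)), (1, g.piece)] [(1, cup (!g.ne)), (0, g.rot.piece)] := by
  refine trans (w' := [(0, cup (!g.sw)), (1, g.piece), (3, cup (!g.ne)), (2, cap g.ne)])
    ((zigzagRight (!g.ne)).symm.replace [!g.sw, g.nw] [] [(0, cup (!g.sw)), (1, g.piece)] []) ?_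
  refine trans (w' := [(0, cup (!g.sw)), (3, cup (!g.ne)), (2, g.rot.piece), (1, cap g.sw)])
    ((turn g).replace [!g.sw] [g.ne] [(0, cup (!g.sw)), (3, cup (!g.ne))] []) ?_
  exact (zigzagLeft (!g.sw)).replace [] [g.nw, g.ne] [(1, cup (!g.ne)), (0, g.rot.piece)] []

end TangleEq
end KnottedGraph

namespace KnottedGraph

open Piece TangleEq

variable {S : Set Move}

/-! ### The moves as tangle equivalences -/

/-- A curl on the right of a strand of direction `a`, of the sign given by `o`, can be removed. -/
def Curl (S : Set Move) (o a : Bool) : Prop :=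
  TangleEq S [a] [a] [(1, cup a), (0, crossing o a a), (1, cap a)] []

/-- A bigon of a left strand of direction `a` and a right strand of direction `b` can be removed;
  the
left strand passes over the right one if `o = true` and under it if `o = false`. -/
def Bigon (S : Set Move) (o a b : Bool) : Prop :=
  TangleEq S [a, b] [a, b] [(0, crossing o a b), (0, crossing (!o) b a)] []

/-- Three strands of directions `d₁`, `d₂`, `d₃` at the bottom can be moved across each other; `oᵢⱼ`
tells whether strand `i` passes over strand `j`. -/
def Triangle (S : Set Move) (d₁ d₂ d₃ o₁₂ o₁₃ o₂₃ : Bool) : Prop :=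
  TangleEq S [d₁, d₂, d₃] [d₃, d₂, d₁]
    [(0, crossing o₁₂ d₁ d₂), (1, crossing o₁₃ d₁ d₃), (0, crossing o₂₃ d₂ d₃)]
    [(1, crossing o₂₃ d₂ d₃), (0, crossing o₁₃ d₁ d₃), (1, crossing o₁₂ d₁ d₂)]

/-- A strand from the bottom left to the top right, of direction `d`, passes over (`o = true`) or
under (`o = false`) a crossing or vertex. -/
def Pass (S : Set Move) (o d : Bool) (g : Quad) : Prop :=
  TangleEq S [d, g.sw, g.se] [g.nw, g.ne, d]
    [(0, crossing o d g.sw), (1, crossing o d g.se), (0, g.piece)]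
    [(1, g.piece), (0, crossing o d g.nw), (1, crossing o d g.ne)]

/-! ### Rotations of relations -/

/-- This is a sixth of a full turn: the third strand is bent round, its crossings turn through a
maximum, and the given triangle is applied backwards. -/
theorem Triangle.rotate {d₁ d₂ d₃ o₁₂ o₁₃ o₂₃ : Bool} (h : Triangle S d₁ d₂ d₃ o₁₂ o₁₃ o₂₃) :
    Triangle S (!d₃) d₁ d₂ (!o₁₃) (!o₂₃) o₁₂ := by
  refine trans (w' := [(3, cup d₃), (0, crossing (!o₁₃) (!d₃) d₁),
    (1, crossing (!o₂₃) (!d₃) d₂), (2, cap (!d₃)), (0, crossing o₁₂ d₁ d₂)])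
    ((zigzagRight d₃).symm.replace [d₁, d₂] [] [(0, crossing (!o₁₃) (!d₃) d₁),
      (1, crossing (!o₂₃) (!d₃) d₂)] [(0, crossing o₁₂ d₁ d₂)]) ?_
  refine trans (w' := [(3, cup d₃), (2, crossing o₂₃ d₂ d₃), (0, crossing (!o₁₃) (!d₃) d₁),
    (1, cap (!d₃)), (0, crossing o₁₂ d₁ d₂)])
    ((turn (.crossing (!o₂₃) (!d₃) d₂)).replace [d₁] [!d₃] [(3, cup d₃),
      (0, crossing (!o₁₃) (!d₃) d₁)] [(0, crossing o₁₂ d₁ d₂)]) ?_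
  refine trans (w' := [(3, cup d₃), (2, crossing o₂₃ d₂ d₃), (1, crossing o₁₃ d₁ d₃),
    (2, crossing o₁₂ d₁ d₂), (0, cap (!d₃))])
    ((turn (.crossing (!o₁₃) (!d₃) d₁)).replace [] [d₂, !d₃] [(3, cup d₃),
      (2, crossing o₂₃ d₂ d₃)] [(0, crossing o₁₂ d₁ d₂)]) ?_
  refine trans (w' := [(3, cup d₃), (1, crossing o₁₂ d₁ d₂), (2, crossing o₁₃ d₁ d₃),
    (1, crossing o₂₃ d₂ d₃), (0, cap (!d₃))])
    (h.symm.replace [!d₃] [!d₃] [(3, cup d₃)] [(0, cap (!d₃))]) ?_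
  refine trans (w' := [(3, cup d₃), (1, crossing o₁₂ d₁ d₂), (2, crossing o₁₃ d₁ d₃),
    (0, crossing (!o₂₃) (!d₃) d₂), (1, cap (!d₃))])
    ((turn (.crossing (!o₂₃) (!d₃) d₂)).symm.replace [] [d₁, !d₃] [(3, cup d₃),
      (1, crossing o₁₂ d₁ d₂), (2, crossing o₁₃ d₁ d₃)] []) ?_
  refine trans (w' := [(3, cup d₃), (1, crossing o₁₂ d₁ d₂), (0, crossing (!o₂₃) (!d₃) d₂),
    (1, crossing (!o₁₃) (!d₃) d₁), (2, cap (!d₃))])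
    ((turn (.crossing (!o₁₃) (!d₃) d₁)).symm.replace [d₂] [!d₃] [(3, cup d₃),
      (1, crossing o₁₂ d₁ d₂), (0, crossing (!o₂₃) (!d₃) d₂)] []) ?_
  exact (zigzagRight d₃).replace [d₂, d₁] [] [(1, crossing o₁₂ d₁ d₂),
    (0, crossing (!o₂₃) (!d₃) d₂), (1, crossing (!o₁₃) (!d₃) d₁)] []

/-- A half-turn puts the curl on the other side of the strand; one turn at a minimum and one at a
maximum bring its crossing back to the given form. -/
theorem Curl.rotate {o a : Bool} (h : Curl S o a) :
    TangleEq S [!a] [!a] [(0, cup a), (1, crossing o (!a) (!a)), (0, cap a)] [] := by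
  refine trans (w' := [(1, cup a), (0, crossing (!o) (!a) a), (0, cap a)])
    ((turnCup (.crossing o (!a) (!a))).replace [] [] [] [(0, cap a)]) ?_
  refine trans (w' := [(1, cup a), (0, crossing (!o) (!a) a), (2, cup a), (1, cap (!a)),
    (0, cap a)])
    ((zigzagRight a).symm.replace [a] [!a] [(1, cup a), (0, crossing (!o) (!a) a)] [(0, cap a)]) ?_
  refine trans (w' := [(1, cup a), (2, cup a), (1, crossing o a a), (0, cap (!a)), (0, cap a)])
    ((turn (.crossing (!o) (!a) a)).replace [] [!a, !a] [(1, cup a), (2, cup a)] [(0, cap a)]) ?_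
  refine trans (w' := [(1, cup a), (0, cap (!a))])
    (h.replace [!a] [!a] [(1, cup a)] [(0, cap (!a))]) ?_
  exact zigzagRight a

/-- A crossing or vertex below two nested local maxima turns by a half-turn. -/
theorem halfTurn (g : Quad) : TangleEq S [g.sw, g.se, !g.ne, !g.nw] []
    [(0, g.piece), (1, cap g.ne), (0, cap g.nw)]
    [(2, g.rot.rot.piece), (1, cap g.se), (0, cap g.sw)] := by
  refine trans (w' := [(1, g.rot.piece), (2, cap g.nw), (0, cap g.sw)])
    ((turn g).replace [] [!g.nw] [] [(0, cap g.nw)]) ?_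
  exact (turn g.rot).replace [g.sw] [] [] [(0, cap g.sw)]

/-- Bending two strands together makes it possible to turn a tangle on two strands as a whole. -/
theorem nestedZigzag (a b : Bool) : TangleEq S [!b, !a] [!b, !a]
    [(0, cup (!b)), (1, cup (!a)), (3, cap b), (2, cap a)] [] := by
  have h := (zigzagLeft (S := S) (!b)).context (p := []) (q := [!a]) (u := [])
    (v := [(1, cup (!a)), (2, cap a)]) (s₀ := [!b, !a]) (t₀ := [!b, !a]) (.nil _)
    (.of_run (by decide +revert))
  rw [Bool.not_not] at h
  -- Settling lowers the maximum `cap b` below the inner minimum, which exposes the outer zigzag.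
  refine (TangleEq.settle (.of_run (by clear * -; decide +revert))).trans (h.trans ?_)
  exact (zigzagLeft (!a)).replace [!b] [] [] []

/-- Under a half-turn the strands exchange places and reverse their directions. The crossings are
carried one by one through the nested zigzag, which also restores their order. -/
theorem Bigon.halfTurn {o a b : Bool} (h : Bigon S o a b) : Bigon S (!o) (!b) (!a) := by
  refine trans (w' := [(0, crossing (!o) (!b) (!a)), (0, crossing o (!a) (!b)), (0, cup (!b)),
    (1, cup (!a)), (3, cap b), (2, cap a)])
    ((nestedZigzag a b).symm.replace [] [] [(0, crossing (!o) (!b) (!a)),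
      (0, crossing o (!a) (!b))] []) ?_
  refine trans (w' := [(0, cup (!b)), (1, cup (!a)), (4, crossing (!o) (!b) (!a)),
    (2, crossing o a b), (3, cap a), (2, cap b)])
    ((KnottedGraph.halfTurn (.crossing o a b)).symm.replace [!b, !a] [] [(0, cup (!b)),
      (1, cup (!a)), (4, crossing (!o) (!b) (!a))] []) ?_
  refine trans (w' := [(0, cup (!b)), (1, cup (!a)), (2, crossing o a b),
    (2, crossing (!o) b a), (3, cap b), (2, cap a)])
    ((KnottedGraph.halfTurn (.crossing (!o) b a)).symm.replace [!b, !a] [] [(0, cup (!b)),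
      (1, cup (!a)), (2, crossing o a b)] []) ?_
  refine trans (w' := [(0, cup (!b)), (1, cup (!a)), (3, cap b), (2, cap a)])
    (h.replace [!b, !a] [!b, !a] [(0, cup (!b)), (1, cup (!a))] [(3, cap b), (2, cap a)]) ?_
  exact nestedZigzag a b

theorem Pass.rotate_bend (g : Quad) : TangleEq S [g.se, !g.ne] [!g.sw, g.nw]
    [(0, g.rot.piece)] [(0, cup (!g.sw)), (1, g.piece), (2, cap g.ne)] := by
  refine trans (w' := [(0, g.rot.piece), (0, cup (!g.sw)), (1, cap g.sw)])
    ((zigzagLeft (!g.sw)).symm.replace [] [g.nw] [(0, g.rot.piece)] []) ?_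
  exact (turn g).symm.replace [!g.sw] [] [(0, cup (!g.sw))] []

/-- The turned piece is the given one with two legs bent. The strand is pushed across one bend,
moved past the piece, and withdrawn from the other bend; each bend costs a bigon. -/
theorem Pass.rotate {o d : Bool} {g : Quad} (hb : ∀ o a b, Bigon S o a b) (h : Pass S o d g) :
    Pass S o d g.rot := by
  refine trans (w' := [(0, crossing o d g.se), (1, crossing o d (!g.ne)), (0, cup (!g.sw)),
    (1, g.piece), (2, cap g.ne)])
    ((Pass.rotate_bend g).replace [] [d] [(0, crossing o d g.se), (1, crossing o d (!g.ne))] []) ?_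
  refine trans (w' := [(0, cup (!g.sw)), (1, crossing (!o) g.sw d), (1, crossing o d g.sw),
    (2, crossing o d g.se), (1, g.piece), (3, crossing o d (!g.ne)), (2, cap g.ne)])
    ((hb (!o) g.sw d).symm.replace [!g.sw] [g.se, !g.ne] [(0, cup (!g.sw))] [(2, crossing o d
      g.se), (1, g.piece), (3, crossing o d (!g.ne)), (2, cap g.ne)]) ?_
  refine trans (w' := [(1, cup (!g.sw)), (0, crossing o d (!g.sw)), (1, crossing o d g.sw),
    (2, crossing o d g.se), (1, g.piece), (3, crossing o d (!g.ne)), (2, cap g.ne)])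
    ((turnCup (.crossing (!o) g.sw d)).replace [] [g.se, !g.ne] [] [(1, crossing o d g.sw),
      (2, crossing o d g.se), (1, g.piece), (3, crossing o d (!g.ne)), (2, cap g.ne)]) ?_
  refine trans (w' := [(1, cup (!g.sw)), (0, crossing o d (!g.sw)), (2, g.piece),
    (1, crossing o d g.nw), (2, crossing o d g.ne), (3, crossing o d (!g.ne)), (2, cap g.ne)])
    (h.replace [!g.sw] [!g.ne] [(1, cup (!g.sw)),
      (0, crossing o d (!g.sw))] [(3, crossing o d (!g.ne)), (2, cap g.ne)]) ?_
  refine trans (w' := [(1, cup (!g.sw)), (0, crossing o d (!g.sw)), (2, g.piece),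
    (1, crossing o d g.nw), (2, crossing o d g.ne), (2, crossing (!o) g.ne d), (3, cap g.ne)])
    ((turn (.crossing (!o) g.ne d)).symm.replace [!g.sw, g.nw] [] [(1, cup (!g.sw)),
      (0, crossing o d (!g.sw)), (2, g.piece), (1, crossing o d g.nw),
        (2, crossing o d g.ne)] []) ?_
  refine trans (w' := [(1, cup (!g.sw)), (0, crossing o d (!g.sw)), (2, g.piece),
    (1, crossing o d g.nw), (3, cap g.ne)])
    ((hb o d g.ne).replace [!g.sw, g.nw] [!g.ne] [(1, cup (!g.sw)), (0, crossing o d (!g.sw)),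
      (2, g.piece), (1, crossing o d g.nw)] [(3, cap g.ne)]) ?_
  exact (Pass.rotate_bend g).symm.replace [d] [] [] [(0, crossing o d (!g.sw)),
    (1, crossing o d g.nw)]

/-! ### Moves of two strands -/

/-- A curl is put on the strand of direction `!a` between the two crossings. Behind the crossing of
the curl, the other strand meets the loop where it runs in direction `a`, so the remaining bigon is
parallel. -/
theorem Bigon.antiparallel {a : Bool} (hc : Curl S true a) (hb : Bigon S a a a)
    (ht : Triangle S (!a) a (!a) (!a) true a) : Bigon S a a (!a) := by
  refine trans (w' := [(0, crossing a a (!a)), (0, cup a), (1, crossing true (!a) (!a)),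
    (0, cap a), (0, crossing (!a) (!a) a)])
    (hc.rotate.symm.replace [] [a] [(0, crossing a a (!a))] [(0, crossing (!a) (!a) a)]) ?_
  refine trans (w' := [(0, cup a), (1, crossing (!a) (!a) a), (2, crossing true (!a) (!a)),
    (1, crossing a a (!a)), (0, cap a)])
    (ht.symm.replace [a] [] [(0, cup a)] [(0, cap a)]) ?_
  refine trans (w' := [(1, cup a), (0, crossing a a a), (2, crossing true (!a) (!a)),
    (1, crossing a a (!a)), (0, cap a)])
    ((turnCup (.crossing (!a) (!a) a)).replace [] [!a] [] [(2, crossing true (!a) (!a)),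
      (1, crossing a a (!a)), (0, cap a)]) ?_
  refine trans (w' := [(1, cup a), (0, crossing a a a), (2, crossing true (!a) (!a)),
    (0, crossing (!a) a a), (1, cap a)])
    ((turn (.crossing (!a) a a)).symm.replace [] [!a] [(1, cup a), (0, crossing a a a),
      (2, crossing true (!a) (!a))] []) ?_
  refine trans (w' := [(1, cup a), (2, crossing true (!a) (!a)), (1, cap a)])
    (hb.replace [] [!a, !a] [(1, cup a)] [(2, crossing true (!a) (!a)), (1, cap a)]) ?_
  exact hc.rotate.replace [a] [] [] []

/-- A crossing of the two legs of a maximum is a curl once one leg is bent. -/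
theorem Curl.cap_crossing {o a : Bool} (h : Curl S o (!a)) :
    TangleEq S [a, !a] [] [(0, crossing (!o) a (!a)), (0, cap (!a))] [(0, cap a)] := by
  refine trans (w' := [(0, cup (!a)), (2, crossing (!o) a (!a)), (1, cap a), (0, cap (!a))])
    ((zigzagLeft (!a)).symm.replace [] [a] [(0, crossing (!o) a (!a))] [(0, cap (!a))]) ?_
  refine trans (w' := [(0, cup (!a)), (1, crossing o a a), (0, cap (!a)), (0, cap a)])
    ((turn (.crossing o a a)).symm.replace [!a] [] [(0, cup (!a))] [(0, cap (!a))]) ?_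
  exact h.rotate.replace [] [!a] [] [(0, cap a)]

/-- A crossing created below the maximum by `Curl.cap_crossing` forms an antiparallel bigon with the
crossing of the curl. -/
theorem Curl.mirror {o a : Bool} (h : Curl S o (!a)) (hb : Bigon S o (!a) a) : Curl S (!o) a := by
  refine trans (w' := [(0, cup a), (1, crossing o (!a) a), (1, cap a)])
    ((turnCup (.crossing o (!a) a)).symm.replace [] [] [] [(1, cap a)]) ?_
  refine trans (w' := [(0, cup a), (1, crossing o (!a) a), (1, crossing (!o) a (!a)),
    (1, cap (!a))])
    (h.cap_crossing.symm.replace [a] [] [(0, cup a), (1, crossing o (!a) a)] []) ?_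
  refine trans (w' := [(0, cup a), (1, cap (!a))])
    (hb.replace [a] [] [(0, cup a)] [(1, cap (!a))]) ?_
  exact zigzagLeft a

/-- The trick of `Bigon.antiparallel` in the other direction: behind the curl the remaining bigon is
antiparallel. -/
theorem Bigon.parallel (hc : Curl S false true) (hb : Bigon S false false true)
    (ht : Triangle S true true true false false true) : Bigon S false true true := by
  refine trans (w' := [(0, crossing false true true), (2, cup true),
    (1, crossing false true true), (2, cap true), (0, crossing true true true)])
    (hc.symm.replace [true] [] [(0, crossing false true true)] [(0, crossing true true true)]) ?_
  refine trans (w' := [(2, cup true), (1, crossing true true true),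
    (0, crossing false true true), (1, crossing false true true), (2, cap true)])
    (ht.replace [] [false] [(2, cup true)] [(2, cap true)]) ?_
  refine trans (w' := [(1, cup true), (2, crossing false false true),
    (0, crossing false true true), (1, crossing false true true), (2, cap true)])
    ((turnCup (.crossing false false true)).symm.replace [true] [] [] [(0, crossing false true
      true), (1, crossing false true true), (2, cap true)]) ?_
  refine trans (w' := [(1, cup true), (2, crossing false false true),
    (0, crossing false true true), (2, crossing true true false), (1, cap true)])
    ((turn (.crossing false true true)).replace [true] [] [(1, cup true),
      (2, crossing false false true), (0, crossing false true true)] []) ?_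
  refine trans (w' := [(1, cup true), (0, crossing false true true), (1, cap true)])
    (hb.replace [true, true] [] [(1, cup true), (0, crossing false true true)] [(1, cap true)]) ?_
  exact hc.replace [] [true] [] []

/-- Conjugation by the crossing of the first two strands: its inverse is put below and above, and
bigons remove the original crossing on either side. -/
theorem Triangle.swap {d₁ d₂ d₃ o₁₂ o₁₃ o₂₃ : Bool} (h : Triangle S d₁ d₂ d₃ o₁₂ o₁₃ o₂₃)
    (hb : Bigon S o₁₂ d₁ d₂) (hb' : Bigon S (!o₁₂) d₂ d₁) : Triangle S d₂ d₁ d₃ (!o₁₂) o₂₃ o₁₃ := by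
  refine trans (w' := [(0, crossing (!o₁₂) d₂ d₁), (1, crossing o₂₃ d₂ d₃),
    (0, crossing o₁₃ d₁ d₃), (1, crossing o₁₂ d₁ d₂), (1, crossing (!o₁₂) d₂ d₁)])
    (hb.symm.replace [d₃] [] [(0, crossing (!o₁₂) d₂ d₁), (1, crossing o₂₃ d₂ d₃),
      (0, crossing o₁₃ d₁ d₃)] []) ?_
  refine trans (w' := [(0, crossing (!o₁₂) d₂ d₁), (0, crossing o₁₂ d₁ d₂),
    (1, crossing o₁₃ d₁ d₃), (0, crossing o₂₃ d₂ d₃), (1, crossing (!o₁₂) d₂ d₁)])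
    (h.symm.replace [] [] [(0, crossing (!o₁₂) d₂ d₁)] [(1, crossing (!o₁₂) d₂ d₁)]) ?_
  exact hb'.replace [] [d₃] [] [(1, crossing o₁₃ d₁ d₃), (0, crossing o₂₃ d₂ d₃),
    (1, crossing (!o₁₂) d₂ d₁)]

/-- The crossings with the upper legs are created together with their inverses; after the given
move, those with the lower legs cancel. -/
theorem Pass.fromRight {o d : Bool} {g : Quad} (hb : ∀ o a b, Bigon S o a b) (h : Pass S o d g) :
    TangleEq S [g.sw, g.se, d] [d, g.nw, g.ne]
      [(1, crossing (!o) g.se d), (0, crossing (!o) g.sw d), (1, g.piece)]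
      [(0, g.piece), (1, crossing (!o) g.ne d), (0, crossing (!o) g.nw d)] := by
  refine trans (w' := [(1, crossing (!o) g.se d), (0, crossing (!o) g.sw d), (1, g.piece),
    (0, crossing o d g.nw), (0, crossing (!o) g.nw d)])
    ((hb o d g.nw).symm.replace [] [g.ne] [(1, crossing (!o) g.se d), (0, crossing (!o) g.sw d),
      (1, g.piece)] []) ?_
  refine trans (w' := [(1, crossing (!o) g.se d), (0, crossing (!o) g.sw d), (1, g.piece),
    (0, crossing o d g.nw), (1, crossing o d g.ne), (1, crossing (!o) g.ne d),
      (0, crossing (!o) g.nw d)])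
    ((hb o d g.ne).symm.replace [g.nw] [] [(1, crossing (!o) g.se d), (0, crossing (!o) g.sw d),
      (1, g.piece), (0, crossing o d g.nw)] [(0, crossing (!o) g.nw d)]) ?_
  refine trans (w' := [(1, crossing (!o) g.se d), (0, crossing (!o) g.sw d),
    (0, crossing o d g.sw), (1, crossing o d g.se), (0, g.piece), (1, crossing (!o) g.ne d),
      (0, crossing (!o) g.nw d)])
    (h.symm.replace [] [] [(1, crossing (!o) g.se d),
      (0, crossing (!o) g.sw d)] [(1, crossing (!o) g.ne d), (0, crossing (!o) g.nw d)]) ?_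
  refine trans (w' := [(1, crossing (!o) g.se d), (1, crossing o d g.se), (0, g.piece),
    (1, crossing (!o) g.ne d), (0, crossing (!o) g.nw d)])
    ((hb (!o) g.sw d).replace [] [g.se] [(1, crossing (!o) g.se d)] [(1, crossing o d g.se),
      (0, g.piece), (1, crossing (!o) g.ne d), (0, crossing (!o) g.nw d)]) ?_
  exact (hb (!o) g.se d).replace [g.sw] [] [] [(0, g.piece), (1, crossing (!o) g.ne d),
    (0, crossing (!o) g.nw d)]

end KnottedGraph

/-! ### Trades of crossings at vertices, and all triangles -/

namespace KnottedGraph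

open Piece TangleEq

variable {S : Set Move}

/-- A half-turn reverses the order of a stack, so a trade between two stacks becomes the trade
between the half-turned ones. -/
theorem halfTurn_pair (g h : Quad) (e₁ : h.sw = g.nw) (e₂ : h.se = g.ne) :
    TangleEq S [!h.ne, !h.nw] [!g.se, !g.sw] [(0, h.rot.rot.piece), (0, g.rot.rot.piece)]
      [(0, cup (!g.se)), (1, cup (!g.sw)), (2, g.piece), (2, h.piece), (3, cap h.ne),
        (2, cap h.nw)] := by
  refine trans (w' := [(0, h.rot.rot.piece), (0, g.rot.rot.piece), (0, cup (!g.se)),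
    (1, cup (!g.sw)), (3, cap g.se), (2, cap g.sw)])
    ((nestedZigzag g.sw g.se).symm.replace [] [] [(0, h.rot.rot.piece),
      (0, g.rot.rot.piece)] [] (hu := by revert e₁ e₂; decide +revert)) ?_
  refine trans (w' := [(0, cup (!g.se)), (1, cup (!g.sw)), (4, h.rot.rot.piece), (2, g.piece),
    (3, cap g.ne), (2, cap g.nw)])
    ((halfTurn g).symm.replace [!g.se, !g.sw] [] [(0, cup (!g.se)), (1, cup (!g.sw)),
      (4, h.rot.rot.piece)] [] (hu := by revert e₁ e₂; decide +revert)) ?_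
  exact (e₁ ▸ e₂ ▸ (halfTurn h).symm : TangleEq S [g.nw, g.ne, !h.ne, !h.nw] [] [(2,
    h.rot.rot.piece), (1, cap g.ne), (0, cap g.nw)] [(0, h.piece), (1, cap h.ne),
      (0, cap h.nw)]).replace [!g.se, !g.sw] [] [(0, cup (!g.se)), (1, cup (!g.sw)),
        (2, g.piece)] []

/-- A relation between a crossing below a piece and one above it also holds for the inverse
crossings. -/
theorem exchange_inverse {o a b c d : Bool} {g h : Piece} (hb : ∀ o a b, Bigon S o a b)
    (hg : IsTangle [(0, g)] [b, a] [d, c]) (hh : IsTangle [(0, h)] [a, b] [c, d])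
    (H : TangleEq S [a, b] [d, c] [(0, crossing o a b), (0, g)] [(0, h), (0, crossing o c d)]) :
    TangleEq S [b, a] [c, d] [(0, crossing (!o) b a), (0, h)] [(0, g), (0, crossing (!o) d c)] := by
  have hc (o a b) : IsTangle [(0, crossing o a b)] [a, b] [b, a] := .of_run (by decide +revert)
  have h₁ := (hb o c d).symm.context (p := []) (q := []) (u := [(0, crossing (!o) b a), (0, h)])
    (v := []) ((hc _ _ _).append hh) (.nil _)
  have h₂ := H.symm.context (p := []) (q := []) (u := [(0, crossing (!o) b a)])
    (v := [(0, crossing (!o) d c)]) (hc _ _ _) (hc _ _ _)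
  have h₃ := (hb (!o) b a).context (p := []) (q := []) (u := [])
    (v := [(0, g), (0, crossing (!o) d c)]) (.nil _) (hg.append (hc _ _ _))
  simp only [List.nil_append, List.append_nil, List.length_nil, shift_zero,
    List.cons_append, Bool.not_not] at h₁ h₂ h₃
  exact h₁.trans (h₂.trans h₃)

/-- A crossing of an incoming and an outgoing edge of an In-In-Out-Out vertex is traded for one of
  the
other two edges, given the trade for two parallel edges. -/
theorem trade_antiparallel {o : Bool} (hb : ∀ o a b, Bigon S o a b) (hc : Curl S o true)
    (hp : ∀ o a b, Pass S o true (.iioo a b))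
    (h : TangleEq S [false, false] [false, false]
      [(0, vertexIIOO false false), (0, crossing (!o) false false)]
      [(0, crossing (!o) false false), (0, vertexIIOO false false)]) :
    TangleEq S [true, false] [true, false]
      [(0, crossing o true false), (0, vertexIIOO false true)]
      [(0, vertexIIOO true false), (0, crossing o false true)] := by
  -- The curl supplies the second crossing that the strand needs to pass the vertex. Vertex and
  -- crossing, turned at the extrema of the curl, then have two downward strands, so that `h`
  -- applies; after that a strand passes the vertex from the right.
  refine trans (w' := [(0, crossing o true false), (2, cup true), (1, crossing o true true),
    (2, cap true), (0, vertexIIOO false true)])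
    (hc.symm.replace [false] [] [(0, crossing o true false)] [(0, vertexIIOO false true)]) ?_
  refine trans (w' := [(2, cup true), (1, vertexIIOO false true), (0, crossing o true true),
    (1, crossing o true false), (2, cap true)])
    ((hp o false true).replace [] [false] [(2, cup true)] [(2, cap true)]) ?_
  refine trans (w' := [(1, cup true), (2, vertexIIOO false false), (0, crossing o true true),
    (1, crossing o true false), (2, cap true)])
    ((turnCup (.iioo false false)).symm.replace [true] [] [] [(0, crossing o true true),
      (1, crossing o true false), (2, cap true)]) ?_
  refine trans (w' := [(1, cup true), (2, vertexIIOO false false), (0, crossing o true true),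
    (2, crossing (!o) false false), (1, cap true)])
    ((turn (.crossing o true false)).replace [true] [] [(1, cup true),
      (2, vertexIIOO false false), (0, crossing o true true)] []) ?_
  refine trans (w' := [(1, cup true), (0, crossing o true true), (2, crossing (!o) false false),
    (2, vertexIIOO false false), (1, cap true)])
    (h.replace [true, true] [] [(1, cup true), (0, crossing o true true)] [(1, cap true)]) ?_
  refine trans (w' := [(1, cup true), (0, crossing o true true), (2, crossing (!o) false false),
    (1, vertexIIOO true false), (2, cap true)])
    ((turn (.iioo true false)).symm.replace [true] [] [(1, cup true), (0, crossing o true true),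
      (2, crossing (!o) false false)] []) ?_
  refine trans (w' := [(2, cup true), (1, crossing o false true), (0, crossing o true true),
    (1, vertexIIOO true false), (2, cap true)])
    ((turnCup (.crossing (!o) false false)).replace [true] [] [] [(0, crossing o true true),
      (1, vertexIIOO true false), (2, cap true)]) ?_
  refine trans (w' := [(2, cup true), (0, vertexIIOO true false), (1, crossing o true true),
    (0, crossing o false true), (2, cap true)])
    (((hp (!o) true false).fromRight hb).replace [] [false] [(2, cup true)] [(2, cap true)]) ?_
  exact hc.replace [false] [] [(0, vertexIIOO true false)] [(0, crossing o false true)]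

/-! ### All triangles -/

section Triangle

variable {d₁ d₂ d₃ o₁₂ o₁₃ o₂₃ : Bool}

/-- Two rotations bring the last two strands to the front; four more complete the full turn. -/
theorem Triangle.swapRight (hb : ∀ o a b, Bigon S o a b) (h : Triangle S d₁ d₂ d₃ o₁₂ o₁₃ o₂₃) :
    Triangle S d₁ d₃ d₂ o₁₃ o₁₂ (!o₂₃) := by
  simpa using (h.rotate.rotate.swap (hb _ _ _) (hb _ _ _)).rotate.rotate.rotate.rotate

/-- A rotation moves the last strand to the front and reverses it; two exchanges carry it back. -/
theorem Triangle.flipRight (hb : ∀ o a b, Bigon S o a b) (h : Triangle S d₁ d₂ d₃ o₁₂ o₁₃ o₂₃) :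
    Triangle S d₁ d₂ (!d₃) o₁₂ o₁₃ o₂₃ := by
  simpa using (h.rotate.swap (hb _ _ _) (hb _ _ _)).swapRight hb

theorem Triangle.flipLeft (hb : ∀ o a b, Bigon S o a b) (h : Triangle S d₁ d₂ d₃ o₁₂ o₁₃ o₂₃) :
    Triangle S (!d₁) d₂ d₃ o₁₂ o₁₃ o₂₃ := by
  simpa using (h.rotate.rotate.flipRight hb).rotate.rotate.rotate.rotate

theorem Triangle.reverse (hb : ∀ o a b, Bigon S o a b) (h : Triangle S d₁ d₂ d₃ o₁₂ o₁₃ o₂₃) :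
    Triangle S d₃ d₂ d₁ (!o₂₃) (!o₁₃) (!o₁₂) := by
  simpa using ((h.swap (hb _ _ _) (hb _ _ _)).swapRight hb).swap (hb _ _ _) (hb _ _ _)

theorem Triangle.monotone (hb : ∀ o a b, Bigon S o a b)
    (h : Triangle S false true false false false false) (o a b : Bool) :
    Triangle S a true b o o o := by
  have h₁ : Triangle S false true false o o o := by
    cases o
    · exact h
    · exact h.reverse hb
  have h₂ : Triangle S a true false o o o := by
    cases a
    · exact h₁
    · exact h₁.flipLeft hb
  cases b
  · exact h₂
  · exact h₂.flipRight hb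

end Triangle

/-! ### Moves of diagrams from tangle equivalences -/

namespace Move

/-- The row of strands at the bottom of a move. -/
def source : Move → List Bool
  | omega1 _ a => [a]
  | omega2 a b => [a, b]
  | omega3 _ a b => [a, true, b]
  | omega4IIOO _ a b => [true, a, b]
  | omega4Alternating _ a => [true, a, !a]
  | omega5Parallel _ => [true, true]
  | omega5Antiparallel _ a => [a, !a]
  | omega5Alternating _ => [true, false]

/-- The row of strands at the top of a move. -/
def target : Move → List Bool
  | omega1 _ a => [a]
  | omega2 a b => [a, b]
  | omega3 _ a b => [b, true, a]
  | omega4IIOO _ a b => [b, a, true]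
  | omega4Alternating _ a => [a, !a, true]
  | omega5Parallel _ => [true, true]
  | omega5Antiparallel _ a => [a, !a]
  | omega5Alternating _ => [false, true]

theorem isTangle_right (m : Move) : IsTangle m.right m.source m.target := by
  apply IsTangle.of_run
  cases m <;> decide +revert

/-- The left side touches all strands of the move and so determines the row; the empty right sides
of Ω1 and Ω2 would not. -/
theorem exists_row_of_left {m : Move} {x y : List Bool} (h : IsTangle m.left x y) :
    ∃ q, x = m.source ++ q ∧ y = m.target ++ q := by
  have h := h.run_eq
  have hnot : ∀ c d : Bool, c = !d → d = !c := by decide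
  cases m <;> rcases x with _ | ⟨x₁, _ | ⟨x₂, _ | ⟨x₃, x⟩⟩⟩ <;>
    simp [left, run, Piece.source, Piece.target, source, target, List.isPrefixOf] at h ⊢ <;>
    grind

end Move

theorem generates_of_tangleEq (h : ∀ m : Move, TangleEq S m.source m.target m.left m.right) :
    Generates S := by
  rintro m D D' ⟨n, u, v, hD, hD'⟩
  obtain ⟨z, hz, hv⟩ := (hD ▸ D.closed).of_append
  obtain ⟨r, hu, hm⟩ := hz.of_append
  -- The left side is never empty, and its first piece has at least `n` strands to its left.
  have hn : n ≤ r.length := by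
    have : ∃ k g w, m.left = (k, g) :: w := by cases m <;> exact ⟨_, _, _, rfl⟩
    obtain ⟨k, g, w, e⟩ := this
    rw [e, shift_cons] at hm
    generalize hW : (n + k, g) :: shift n w = W at hm
    cases hm with
    | nil => simp at hW
    | cons g' w' p q _ _ =>
      simp only [List.cons.injEq, Prod.mk.injEq] at hW
      simp; omega
  obtain ⟨p, x, y, rfl, rfl, rfl, hm'⟩ := hm.of_shift hn
  obtain ⟨q, rfl, rfl⟩ := Move.exists_row_of_left hm'
  exact (h m).joined p q u v (by simpa using hu) (by simpa using hv) D D' hD hD'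

end KnottedGraph

/-! ### The ten moves generate -/

namespace KnottedGraph

open Piece TangleEq Move

theorem generates_standard :
    Generates ({Ω1a, Ω1b, Ω2a, Ω3a, Ω4a, Ω4e, Ω5a, Ω4j, Ω4l, Ω5g} : Set Move) := by
  generalize hS : ({Ω1a, Ω1b, Ω2a, Ω3a, Ω4a, Ω4e, Ω5a, Ω4j, Ω4l, Ω5g} : Set Move) = S
  have base (m : Move) (hm : m ∈ S) (h : run m.source m.left = some m.target) :
      TangleEq S m.source m.target m.left m.right :=
    .of_move hm (.of_run h) m.isTangle_right
  have c₁ : Curl S true true := base Ω1a (by simp [← hS]) (by decide)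
  have c₂ : Curl S true false := base Ω1b (by simp [← hS]) (by decide)
  have b₁ : Bigon S true true true := base Ω2a (by simp [← hS]) (by decide)
  have t₁ : Triangle S false true false false false false := base Ω3a (by simp [← hS]) (by decide)
  have b₂ : Bigon S false false false := b₁.halfTurn
  have b₃ : Bigon S true true false := Bigon.antiparallel c₁ b₁ t₁.rotate.rotate
  have b₄ : Bigon S false false true := Bigon.antiparallel c₂ b₂ t₁.rotate
  have b₅ : Bigon S true false true := b₄.halfTurn
  have b₆ : Bigon S false true false := b₃.halfTurn
  have c₃ : Curl S false true := Curl.mirror (o := true) c₂ b₅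
  have c₄ : Curl S false false := Curl.mirror (o := true) c₁ b₃
  have b₇ : Bigon S false true true :=
    Bigon.parallel c₃ b₄ (t₁.swap b₄ b₃).rotate.rotate
  have b₈ : Bigon S true false false := b₇.halfTurn
  have hc (o a) : Curl S o a := by cases o <;> cases a <;> assumption
  have hb (o a b) : Bigon S o a b := by cases o <;> cases a <;> cases b <;> assumption
  have hp (o a b) : Pass S o true (.iioo a b) := by
    have h : Pass S o true (.iioo false true) := by
      cases o
      · exact base Ω4e (by simp [← hS]) (by decide)
      · exact base Ω4a (by simp [← hS]) (by decide)
    -- Right-angle turns carry the directions `(false, true)` through `(true, true)` and `(true,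
    -- false)` to `(false, false)`.
    cases a <;> cases b
    · exact (h.rotate hb).rotate hb |>.rotate hb
    · exact h
    · exact (h.rotate hb).rotate hb
    · exact h.rotate hb
  have ha (o a) : Pass S o true (.alternating a) := by
    have h : Pass S o true (.alternating false) := by
      cases o
      · exact base Ω4j (by simp [← hS]) (by decide)
      · exact base Ω4l (by simp [← hS]) (by decide)
    cases a
    · exact h
    · exact h.rotate hb
  have par (o) : TangleEq S [true, true] [true, true]
      (omega5Parallel o).left (omega5Parallel o).right := by
    have h : TangleEq S [true, true] [true, true] Ω5a.left Ω5a.right :=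
      base Ω5a (by simp [← hS]) (by decide)
    cases o
    · exact exchange_inverse hb (.of_run (by decide)) (.of_run (by decide)) h
    · exact h
  have par' (o) : TangleEq S [false, false] [false, false]
      [(0, vertexIIOO false false), (0, crossing o false false)]
      [(0, crossing o false false), (0, vertexIIOO false false)] := by
    have h₁ := halfTurn_pair (S := S) (.crossing o true true) (.iioo true true) rfl rfl
    have h₂ := (par o).replace [false, false] [false, false] [(0, cup false), (1, cup false)]
      [(3, cap true), (2, cap true)]
      (w := [(0, cup false), (1, cup false), (2, crossing o true true), (2, vertexIIOO true true),
        (3, cap true), (2, cap true)])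
      (w' := [(0, cup false), (1, cup false), (2, vertexIIOO true true), (2, crossing o true true),
        (3, cap true), (2, cap true)]) (s := [false, false]) (t := [false, false])
    have h₃ := halfTurn_pair (S := S) (.iioo true true) (.crossing o true true) rfl rfl
    simpa [Quad.rot, Quad.piece, Quad.sw, Quad.se, Quad.nw, Quad.ne] using h₁.trans (h₂.trans
      h₃.symm)
  have anti (o) : TangleEq S [true, false] [true, false]
      (omega5Antiparallel o true).left (omega5Antiparallel o true).right :=
    trade_antiparallel hb (hc o true) hp (par' _)
  have alt : TangleEq S [true, false] [false, true]
      (omega5Alternating true).left (omega5Alternating true).right :=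
    base Ω5g (by simp [← hS]) (by decide)
  apply generates_of_tangleEq
  rintro (⟨o, a⟩ | ⟨a, b⟩ | ⟨o, a, b⟩ | ⟨o, a, b⟩ | ⟨o, a⟩ | ⟨o⟩ | ⟨o, a⟩ | ⟨o⟩)
  · exact hc o a
  · exact hb true a b
  · exact t₁.monotone hb o a b
  · exact hp o a b
  · exact ha o a
  · exact par o
  · cases a
    · have h := exchange_inverse hb (.of_run (by decide)) (.of_run (by decide)) (anti (!o))
      rwa [Bool.not_not] at h
    · exact anti o
  · cases o
    · have h₀ := exchange_inverse hb (.of_run (by decide)) (.of_run (by decide)) alt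
      have h₁ := halfTurn_pair (S := S) (.alternating false) (.crossing false false true) rfl rfl
      have h₂ := h₀.symm.replace [false, true] [true, false] [(0, cup false), (1, cup true)]
        [(3, cap false), (2, cap true)]
        (w := [(0, cup false), (1, cup true), (2, vertexAlternating false),
          (2, crossing false false true), (3, cap false), (2, cap true)])
        (w' := [(0, cup false), (1, cup true), (2, crossing false false true),
          (2, vertexAlternating true), (3, cap false), (2, cap true)])
        (s := [true, false]) (t := [false, true])
      have h₃ := halfTurn_pair (S := S) (.crossing false false true) (.alternating true) rfl rfl
      exact h₁.trans (h₂.trans h₃.symm)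
    · exact alt

end KnottedGraph

namespace KnottedGraph

/-! ### Colouring invariants -/

/-- Rules for colouring the strands of a diagram by `Fin k`. At crossings and vertices the colours
  at
the top are related to the colours at the bottom; `turn` is the difference of the colours of the
  right
and the left leg of a local minimum. -/
structure Colouring (k : ℕ) where
  turn : Fin k
  crossing : Bool → Bool → Bool → Fin k → Fin k → List (Fin k × Fin k)
  vertexIIOO : Bool → Bool → Fin k → Fin k → List (Fin k × Fin k)
  vertexAlternating : Bool → Fin k → Fin k → List (Fin k × Fin k)

namespace Colouring

variable {k : ℕ} (C : Colouring k)

/-- The possible rows of colours at the top of a piece with given colours at the bottom. -/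
def rel : Piece → List (Fin k) → List (List (Fin k))
  | .cup _, _ => (List.finRange k).map fun y => [y, y + C.turn]
  | .cap _, [x, y] => if x = y + C.turn then [[]] else []
  | .crossing o a b, [x, y] => (C.crossing o a b x y).map fun z => [z.1, z.2]
  | .vertexIIOO a b, [x, y] => (C.vertexIIOO a b x y).map fun z => [z.1, z.2]
  | .vertexAlternating a, [x, y] => (C.vertexAlternating a x y).map fun z => [z.1, z.2]
  | _, _ => []

theorem length_of_mem_rel {g : Piece} {l m : List (Fin k)} (h : m ∈ C.rel g l) :
    m.length = g.target.length := by
  unfold rel at h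
  split at h <;> try split_ifs at h
  all_goals simp [Piece.target] at h ⊢
  all_goals grind

/-- The possible rows of colours above a slice. The row of colours is infinite to the right, so that
strands may be added there. -/
def slice : ℕ → Piece → Stream' (Fin k) → Multiset (Stream' (Fin k))
  | 0, g, x => (C.rel g (x.take g.source.length) : Multiset _).map
      (· ++ₛ x.drop g.source.length)
  | n + 1, g, x => (slice n g x.tail).map (Stream'.cons x.head)

/-- The possible rows of colours above a tangle word, with multiplicities. -/
def extend : Word → Stream' (Fin k) → Multiset (Stream' (Fin k))
  | [], x => {x}
  | (n, g) :: w, x => (C.slice n g x).bind (extend w)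

theorem slice_append (l : List (Fin k)) (n : ℕ) (g : Piece) (x : Stream' (Fin k)) :
    C.slice (l.length + n) g (l ++ₛ x) = (C.slice n g x).map (l ++ₛ ·) := by
  induction l with
  | nil => simp
  | cons a l ih =>
    have : (a :: l).length + n = (l.length + n) + 1 := by simp; omega
    rw [this, slice, Stream'.cons_append_stream, Stream'.tail_cons, Stream'.head_cons, ih,
      Multiset.map_map]
    rfl

theorem slice_zero_append (l : List (Fin k)) (g : Piece) (hl : l.length = g.source.length)
    (x : Stream' (Fin k)) :
    C.slice 0 g (l ++ₛ x) = (C.rel g l : Multiset _).map (· ++ₛ x) := by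
  rw [slice, ← hl, Stream'.drop_append_stream]
  congr 3
  simpa using Stream'.take_append_of_le_length (a := x) (x := l) (n := l.length) le_rfl

theorem extend_append (u v : Word) (x : Stream' (Fin k)) :
    C.extend (u ++ v) x = (C.extend u x).bind (C.extend v) := by
  induction u generalizing x with
  | nil => simp [extend]
  | cons a u ih =>
    rw [List.cons_append, extend, extend, Multiset.bind_assoc]
    exact Multiset.bind_congr fun y _ => ih y

theorem extend_shift (l : List (Fin k)) (w : Word) (x : Stream' (Fin k)) :
    C.extend (shift l.length w) (l ++ₛ x) = (C.extend w x).map (l ++ₛ ·) := by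
  induction w generalizing x with
  | nil => simp [extend]
  | cons a w ih =>
    rw [shift_cons, extend, extend, slice_append, Multiset.bind_map, Multiset.map_bind]
    exact Multiset.bind_congr fun y _ => ih y

/-- Two tangle words with the same colourings. -/
def Respects (L R : Word) : Prop := ∀ x, C.extend L x = C.extend R x

variable {C}

theorem Respects.of_replaces {L R : Word} (h : C.Respects L R) {D D' : Diagram}
    (hD : Replaces L R D D') : C.Respects D.word D'.word := by
  obtain ⟨n, u, v, e, e'⟩ := hD
  intro x
  rw [e, e', extend_append, extend_append, extend_append, extend_append]
  congr 2
  funext y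
  have hy := Stream'.append_take_drop n y
  have hn : (y.take n).length = n := Stream'.length_take n y
  have h₁ := C.extend_shift (y.take n) L (y.drop n)
  have h₂ := C.extend_shift (y.take n) R (y.drop n)
  rw [hy, hn] at h₁ h₂
  rw [h₁, h₂, h]

/-- Neither piece reads colours of the other, so the two choices commute, multiplicities included.
-/
theorem respects_exchange (g h : Piece) (m : ℕ) :
    C.Respects [(0, g), (g.target.length + m, h)] [(g.source.length + m, h), (0, g)] := by
  intro x
  obtain ⟨l, y, hl, rfl⟩ : ∃ l y, l.length = g.source.length ∧ l ++ₛ y = x :=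
    ⟨_, _, Stream'.length_take _ x, Stream'.append_take_drop _ x⟩
  simp only [extend]
  rw [slice_zero_append _ _ _ hl, ← hl, slice_append, Multiset.bind_map, Multiset.bind_map]
  calc
    _ = (C.rel g l : Multiset _).bind fun a => (C.slice m h y).bind fun b => {a ++ₛ b} := by
      refine Multiset.bind_congr fun a ha => ?_
      rw [← C.length_of_mem_rel (Multiset.mem_coe.1 ha), slice_append, Multiset.bind_singleton,
        Multiset.bind_singleton, Multiset.map_id']
    _ = _ := by
      rw [Multiset.bind_bind]
      refine Multiset.bind_congr fun b _ => ?_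
      rw [slice_zero_append _ _ _ hl, Multiset.bind_singleton, Multiset.bind_singleton,
        Multiset.map_id']

/-! ### Colourings of finite rows and their enumeration -/

variable (C)

/-- The possible rows of colours above a slice, for a finite row. -/
def sliceRow : ℕ → Piece → List (Fin k) → List (List (Fin k))
  | 0, g, l => (C.rel g (l.take g.source.length)).map (· ++ l.drop g.source.length)
  | _ + 1, _, [] => []
  | n + 1, g, a :: l => (sliceRow n g l).map (a :: ·)

/-- The possible rows of colours above a tangle word, for a finite row. -/
def extendRow : Word → List (Fin k) → List (List (Fin k))
  | [], l => [l]
  | (n, g) :: w, l => (C.sliceRow n g l).flatMap (extendRow w)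

/-- A row of `n` strands is long enough for a tangle word. -/
def fits : Word → ℕ → Bool
  | [], _ => true
  | (j, g) :: w, n =>
    decide (j + g.source.length ≤ n) && fits w (n - g.source.length + g.target.length)

theorem slice_row {n : ℕ} {g : Piece} {l : List (Fin k)} (h : n + g.source.length ≤ l.length)
    (x : Stream' (Fin k)) :
    C.slice n g (l ++ₛ x) = (C.sliceRow n g l : Multiset _).map (· ++ₛ x) := by
  induction n generalizing l with
  | zero =>
    obtain ⟨a, b, ha, rfl⟩ : ∃ a b, a.length = g.source.length ∧ l = a ++ b :=
      ⟨l.take g.source.length, l.drop g.source.length, by simpa using h, by simp⟩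
    rw [Stream'.append_append_stream, C.slice_zero_append a g ha, sliceRow, ← ha]
    simp [Function.comp_def, Stream'.append_append_stream]
  | succ n ih =>
    cases l with
    | nil => simp at h
    | cons a l =>
      rw [Stream'.cons_append_stream, slice, Stream'.tail_cons, Stream'.head_cons,
        ih (by simp at h; omega), sliceRow]
      simp [Function.comp_def, Stream'.cons_append_stream]

theorem length_of_mem_sliceRow {n : ℕ} {g : Piece} {l m : List (Fin k)}
    (hl : n + g.source.length ≤ l.length) (h : m ∈ C.sliceRow n g l) :
    m.length = l.length - g.source.length + g.target.length := by
  induction n generalizing l m with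
  | zero =>
    simp only [sliceRow, List.mem_map] at h
    obtain ⟨a, ha, rfl⟩ := h
    rw [List.length_append, C.length_of_mem_rel ha, List.length_drop, Nat.add_comm]
  | succ n ih =>
    cases l with
    | nil => simp at hl
    | cons a l =>
      simp only [sliceRow, List.mem_map] at h
      obtain ⟨b, hb, rfl⟩ := h
      have := ih (by simp at hl; omega) hb
      simp at hl ⊢
      omega

theorem extend_row {w : Word} {l : List (Fin k)} (h : fits w l.length = true)
    (x : Stream' (Fin k)) :
    C.extend w (l ++ₛ x) = (C.extendRow w l : Multiset _).map (· ++ₛ x) := by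
  induction w generalizing l with
  | nil => simp [extend, extendRow]
  | cons a w ih =>
    obtain ⟨n, g⟩ := a
    simp only [fits, Bool.and_eq_true, decide_eq_true_eq] at h
    rw [extend, extendRow, C.slice_row h.1, Multiset.bind_map, ← Multiset.coe_bind,
      Multiset.map_bind]
    refine Multiset.bind_congr fun m hm => ih ?_
    rw [C.length_of_mem_sliceRow h.1 (Multiset.mem_coe.1 hm)]
    exact h.2

/-- All rows of `n` colours. -/
def allRows (k : ℕ) : ℕ → List (List (Fin k))
  | 0 => [[]]
  | n + 1 => (List.finRange k).flatMap fun a => (allRows k n).map (a :: ·)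

theorem mem_allRows (l : List (Fin k)) : l ∈ allRows k l.length := by
  induction l with
  | nil => simp [allRows]
  | cons a l ih => simp [allRows, ih]

/-- Two tangle words on `n` strands have the same colourings. -/
def check (n : ℕ) (L R : Word) : Bool :=
  fits L n && fits R n && (allRows k n).all fun l => (C.extendRow L l).isPerm (C.extendRow R l)

variable {C}

theorem Respects.of_check {n : ℕ} {L R : Word} (h : C.check n L R = true) : C.Respects L R := by
  simp only [check, Bool.and_eq_true, List.all_eq_true, List.isPerm_iff] at h
  intro x
  have hn : (x.take n).length = n := Stream'.length_take n x
  have hp := h.2 (x.take n) (by simpa only [hn] using mem_allRows (x.take n))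
  rw [← Stream'.append_take_drop n x, C.extend_row (by rw [hn]; exact h.1.1),
    C.extend_row (by rw [hn]; exact h.1.2), Multiset.coe_eq_coe.2 hp]

/-! ### Invariance under isotopies and the criterion for a move to be needed -/

variable (C)

/-- The colourings are invariant under planar isotopies. -/
abbrev Planar : Prop :=
  (∀ a, C.check 1 [(0, .cup a), (1, .cap (!a))] [] = true) ∧
  (∀ a, C.check 1 [(1, .cup a), (0, .cap (!a))] [] = true) ∧
  (∀ o a b, C.check 3 [(0, .crossing o a b), (1, .cap a)]
    [(1, .crossing (!o) b (!a)), (0, .cap a)] = true) ∧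
  (∀ a b, C.check 3 [(0, .vertexIIOO a b), (1, .cap a)]
    [(1, .vertexIIOO b (!a)), (0, .cap a)] = true) ∧
  ∀ a, C.check 3 [(0, .vertexAlternating a), (1, .cap (!a))]
    [(1, .vertexAlternating (!a)), (0, .cap a)] = true

variable {C}

theorem respects_planarRule (hC : C.Planar) {L R : Word} (h : PlanarRule L R) :
    C.Respects L R := by
  obtain ⟨h₁, h₂, h₃, h₄, h₅⟩ := hC
  cases h with
  | exchange g h m => exact respects_exchange g h m
  | zigzagLeft a => exact .of_check (h₁ a)
  | zigzagRight a => exact .of_check (h₂ a)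
  | turnCrossing o a b => exact .of_check (h₃ o a b)
  | turnIIOO a b => exact .of_check (h₄ a b)
  | turnAlternating a => exact .of_check (h₅ a)

theorem respects_of_joined {S : Set Move} (hC : C.Planar)
    (hS : ∀ m ∈ S, C.Respects m.left m.right) {D D' : Diagram} (h : Joined S D D') :
    C.Respects D.word D'.word := by
  induction h with
  | rel D D' h =>
    obtain ⟨L, R, h, hD⟩ | ⟨m, hm, hD⟩ := h
    · exact (respects_planarRule hC h).of_replaces hD
    · exact (hS m hm).of_replaces hD
  | refl => exact fun _ => rfl
  | symm _ _ _ ih => exact fun x => (ih x).symm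
  | trans _ _ _ _ _ ih₁ ih₂ => exact fun x => (ih₁ x).trans (ih₂ x)

/-- A move that changes the number of colourings of some diagram, while the other moves of a set
preserve colourings, is needed in the set. -/
theorem mem_of_generates {S : Set Move} {m : Move} (C : Colouring k) (hC : C.Planar)
    (hS : ∀ m' ∈ S, m' ≠ m → C.check m'.source.length m'.left m'.right = true) (n : ℕ) (u v : Word)
    (hL : run [] (u ++ shift n m.left ++ v) = some [])
    (hR : run [] (u ++ shift n m.right ++ v) = some [])
    (hf : fits (u ++ shift n m.left ++ v) 0 = true) (hf' : fits (u ++ shift n m.right ++ v) 0 =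
      true)
    (hne : (C.extendRow (u ++ shift n m.left ++ v) []).length ≠
      (C.extendRow (u ++ shift n m.right ++ v) []).length)
    {T : Set Move} (hT : T ⊆ S) (h : Generates T) : m ∈ T := by
  by_contra hm
  have hJ := h m ⟨_, .of_run hL⟩ ⟨_, .of_run hR⟩ ⟨n, u, v, rfl, rfl⟩
  have hr := respects_of_joined hC
    (fun m' hm' => .of_check (hS m' (hT hm') fun e => hm (e ▸ hm'))) hJ
  -- A closed word touches no entry of the stream, so any stream serves; `C.turn` is merely an
  -- available colour.
  have hx := congrArg Multiset.card (hr ([] ++ₛ Stream'.const C.turn))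
  rw [C.extend_row hf, C.extend_row hf'] at hx
  simp only [Multiset.card_map, Multiset.coe_card] at hx
  exact hne hx

end Colouring
end KnottedGraph

/-! ### The invariants and minimality -/

namespace KnottedGraph

deriving instance DecidableEq for Move

namespace Colouring

open Piece Move

/-- Links coloured by `Fin 3`, the colour of a strand changing by the writhe, plus `s` times the
rotation, along the strand. -/
def writheRotation (s : Fin 3) : Colouring 3 where
  turn := s
  crossing o a b x y :=
    -- `ε` is the sign. Only the over-strand changes colour, by `-ε` along its direction.
    let ε := o == (a == b)
    if o then [(y, if ε == a then x - 1 else x + 1)] else [(if ε == b then y - 1 else y + 1, x)]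
  -- A diagram with a vertex has no colourings, so moves at vertices are respected trivially.
  vertexIIOO _ _ _ _ := []
  vertexAlternating _ _ _ := []

/-- Links with a colour for each part of the underlying plane curve. -/
def parts : Colouring 2 where
  turn := 0
  crossing _ _ _ x y := if x = y then [(x, x)] else []
  vertexIIOO _ _ _ _ := []
  vertexAlternating _ _ _ := []

/-- Links coloured by `Fin 3` with an operation that is not self-distributive. -/
def nondistributive : Colouring 3 where
  turn := 0
  crossing o _ _ x y := if o then [(op y x, x)] else [(y, op x y)]
  vertexIIOO _ _ _ _ := []
  vertexAlternating _ _ _ := []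
where
  /-- Exchange `1`, `2` under `0`, exchange `0`, `2` under `1`, and fix all under `2`. -/
  op (x y : Fin 3) : Fin 3 := if y = 0 then -x else if y = 1 then 2 - x else x

/-- Fox colourings, the strands at the vertices having the colour `0`; the crossings are mirrored if
`m = false`. -/
def fox (m iioo alternating : Bool) : Colouring 3 where
  turn := 0
  crossing o _ _ x y := if o = m then [(-x - y, x)] else [(y, -x - y)]
  vertexIIOO _ _ x y := if iioo = true ∧ x = 0 ∧ y = 0 then [(0, 0)] else []
  vertexAlternating _ x y := if alternating = true ∧ x = 0 ∧ y = 0 then [(0, 0)] else []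

/-- Colourings that prescribe the colour of every leg of an In-In-Out-Out vertex. -/
def prescribed : Colouring 2 where
  turn := 0
  crossing _ _ _ x y := [(y, x)]
  vertexIIOO a b x y :=
    -- Seen along the flow through the vertex, the left edges have colour `0` and the right edges
    -- colour `1`, a rule invariant under rotation.
    if x = (if b then 0 else 1) ∧ y = (if a then 1 else 0) then
      [(if a then 0 else 1, if b then 1 else 0)] else []
  vertexAlternating _ _ _ := []

/-- Colourings that smooth the In-Out-In-Out vertices. -/
def smoothing : Colouring 2 where
  turn := 0
  crossing _ _ _ x y := [(y, x)]
  vertexIIOO _ _ _ _ := []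
  -- Each incoming edge is joined to the next outgoing edge clockwise, so the colours of the
  -- resulting closed curves are free.
  vertexAlternating a x y := if a then [(x, y)] else if x = y then [(0, 0), (1, 1)] else []

end Colouring

open Piece Move

theorem subset_of_generates {T : Set Move}
    (hT : T ⊆ {Ω1a, Ω1b, Ω2a, Ω3a, Ω4a, Ω4e, Ω5a, Ω4j, Ω4l, Ω5g}) (h : Generates T) :
    {Ω1a, Ω1b, Ω2a, Ω3a, Ω4a, Ω4e, Ω5a, Ω4j, Ω4l, Ω5g} ⊆ T := by
  rintro m (rfl | rfl | rfl | rfl | rfl | rfl | rfl | rfl | rfl | rfl)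
  -- Modulo 3, the writhe and the rotation of a curl cancel for Ω1b if `s = 2` and for Ω1a if `s =
  -- 1`. In either case the bare circle has no colouring and the curled one has three.
  · exact Colouring.mem_of_generates (.writheRotation 2) (by decide)
      (by rintro _ (rfl | rfl | rfl | rfl | rfl | rfl | rfl | rfl | rfl | rfl) <;> decide)
      0 [(0, cup true)] [(0, cap true)]
      (by decide) (by decide) (by decide) (by decide) (by decide) hT h
  · exact Colouring.mem_of_generates (.writheRotation 1) (by decide)
      (by rintro _ (rfl | rfl | rfl | rfl | rfl | rfl | rfl | rfl | rfl | rfl) <;> decide)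
      0 [(0, cup false)] [(0, cap false)]
      (by decide) (by decide) (by decide) (by decide) (by decide) hT h
  -- Ω2a joins two nested circles into one part.
  · exact Colouring.mem_of_generates .parts (by decide)
      (by rintro _ (rfl | rfl | rfl | rfl | rfl | rfl | rfl | rfl | rfl | rfl) <;> decide)
      0 [(0, cup true), (1, cup true)] [(1, cap true), (0, cap true)]
      (by decide) (by decide) (by decide) (by decide) (by decide) hT h
  -- Ω1 and Ω2 need only that `op` is idempotent and that each `op · y` is an involution.
  · exact Colouring.mem_of_generates .nondistributive (by decide)
      (by rintro _ (rfl | rfl | rfl | rfl | rfl | rfl | rfl | rfl | rfl | rfl) <;> decide)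
      0 [(0, cup false), (1, cup true), (2, cup false)]
      [(0, crossing false false true), (0, crossing false true false), (2, cap false),
        (1, cap true),
        (0, cap false)]
      (by decide) (by decide) (by decide) (by decide) (by decide) hT h
  -- A strand going under two edges of colour `0` changes sign twice on either side of the move;
  -- going over, it spoils the colour `0`. Here a strand that lies over all edges around a vertex
  -- must have colour `0`, and is free once it has slipped off. Mirroring exchanges over and under.
  · exact Colouring.mem_of_generates (.fox true true false) (by decide)
      (by rintro _ (rfl | rfl | rfl | rfl | rfl | rfl | rfl | rfl | rfl | rfl) <;> decide)
      0 [(0, cup true), (1, cup true), (2, cup false), (1, vertexIIOO true false)]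
      [(1, crossing false false true), (0, crossing false true true), (2, cap false), (1, cap true),
        (0, cap true)]
      (by decide) (by decide) (by decide) (by decide) (by decide) hT h
  · exact Colouring.mem_of_generates (.fox false true false) (by decide)
      (by rintro _ (rfl | rfl | rfl | rfl | rfl | rfl | rfl | rfl | rfl | rfl) <;> decide)
      0 [(0, cup true), (1, cup true), (2, cup false), (1, vertexIIOO true false)]
      [(1, crossing true false true), (0, crossing true true true), (2, cap false), (1, cap true),
        (0, cap true)]
      (by decide) (by decide) (by decide) (by decide) (by decide) hT h
  -- The crossing between the two vertices presents the prescribed colours in the wrong order; when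
  -- it is moved above the second vertex, it cancels against the last crossing.
  · exact Colouring.mem_of_generates .prescribed (by decide)
      (by rintro _ (rfl | rfl | rfl | rfl | rfl | rfl | rfl | rfl | rfl | rfl) <;> decide)
      0 [(0, cup true), (1, cup true), (0, vertexIIOO true true)]
      [(0, crossing true true true), (1, cap true), (0, cap true)]
      (by decide) (by decide) (by decide) (by decide) (by decide) hT h
  · exact Colouring.mem_of_generates (.fox false false true) (by decide)
      (by rintro _ (rfl | rfl | rfl | rfl | rfl | rfl | rfl | rfl | rfl | rfl) <;> decide)
      0 [(0, cup true), (1, cup false), (2, cup true), (1, vertexAlternating false)]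
      [(1, crossing true true true), (0, crossing true false true), (2, cap true), (1, cap false),
        (0, cap true)]
      (by decide) (by decide) (by decide) (by decide) (by decide) hT h
  · exact Colouring.mem_of_generates (.fox true false true) (by decide)
      (by rintro _ (rfl | rfl | rfl | rfl | rfl | rfl | rfl | rfl | rfl | rfl) <;> decide)
      0 [(0, cup true), (1, cup false), (2, cup true), (1, vertexAlternating false)]
      [(1, crossing false true true), (0, crossing false false true), (2, cap true), (1, cap false),
        (0, cap true)]
      (by decide) (by decide) (by decide) (by decide) (by decide) hT h
  -- After smoothing, one side closes up to two curves and the other side to one.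
  · exact Colouring.mem_of_generates .smoothing (by decide)
      (by rintro _ (rfl | rfl | rfl | rfl | rfl | rfl | rfl | rfl | rfl | rfl) <;> decide)
      0 [(0, cup true)] [(0, cap false)]
      (by decide) (by decide) (by decide) (by decide) (by decide) hT h

end KnottedGraph

open KnottedGraph KnottedGraph.Move in
theorem theorem3p5 :
    Minimal Generates ({Ω1a, Ω1b, Ω2a, Ω3a, Ω4a, Ω4e, Ω5a, Ω4j, Ω4l, Ω5g} : Set Move) :=
  ⟨generates_standard, fun _ hT hle => subset_of_generates hle hT⟩
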